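/- Let $2^\omega$ be Cantor space with the product topology, and let $\equiv_T$ be Turing equivalence on $2^\omega$: $x\equiv_T y$ if and only if $x$ is recursive in $y$ and $y$ is recursive in $x$. An equivalence relation $E$ on a Polish space $X$ is called (uniformly) learnable if there are continuous functions $l_n\colon X^\omega\times X\to\omega$ ($n\in\omega$, with $\omega$ discrete) such that for all $x\in X$ and $\vec x=(x_i)_{i\in\omega}\in X^\omega$ with $x\mathrel{E}x_i$ for some $i$, the limit $k=\lim_n l_n(\vec x,x)$ exists and $x\mathrel{E}x_k$. Theorem. (1) Turing equivalence is not learnable. (2) In fact, as a subset of $2^\omega\times 2^\omega$, Turing equivalence is not boldface $\mathbf{\Pi}^0_3$. (3) Consequently, Turing equivalence is boldface $\mathbf{\Sigma}^0_3$-complete: it is a $\mathbf{\Sigma}^0_3$ subset of $2^\omega\times 2^\omega$, and for every zero-dimensional Polish space $X$ and every $\mathbf{\Sigma}^0_3$ set $B\subseteq X$ there is a continuous $f\colon X\to 2^\omega\times 2^\omega$ with $B=\{z\in X: f(z)\in{\equiv_T}\}$. -/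

import Mathlib

universe u v

/-- Cantor space, the space of infinite binary sequences with the product topology. -/
abbrev CantorSeq : Type := ℕ → Bool

/-- The characteristic function of a real, as a (total) function on the natural numbers. -/
def CantorSeq.charFun (x : CantorSeq) : ℕ →. ℕ := fun n => Part.some (x n).toNat

/-- Turing equivalence of two reals: each one is recursive in the other. -/
def TuringEquivReal (x y : CantorSeq) : Prop :=
  TuringEquivalent x.charFun y.charFun

/-- An equivalence relation `E` on a topological space `X` is (uniformly) learnable if there are
continuous functions `l n` from `X^ℕ × X` to the discrete space `ℕ` such that, whenever `x` is
`E`-equivalent to some entry of the sequence `xs`, the limit `k` of `l n (xs, x)` exists and `x` is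
`E`-equivalent to the entry `xs k`. -/
def IsLearnable {X : Type*} [TopologicalSpace X] (E : X → X → Prop) : Prop :=
  ∃ l : ℕ → (ℕ → X) × X → ℕ, (∀ n, Continuous (l n)) ∧
    ∀ (xs : ℕ → X) (x : X), (∃ i, E x (xs i)) →
      ∃ k, Filter.Tendsto (fun n => l n (xs, x)) Filter.atTop (nhds k) ∧ E x (xs k)

/-- The finite levels of the boldface Borel hierarchy: `BoldSigma n A` says that `A` is a boldface
`Σ⁰ₙ` subset of `X`. The levels start at `n = 1` with the open sets (nothing is of level `0`), and
a `Σ⁰ₙ₊₁` set is a countable union of complements of `Σ⁰ₙ` sets. -/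
def BoldSigma {X : Type*} [TopologicalSpace X] : ℕ → Set X → Prop
  | 0, _ => False
  | 1, A => IsOpen A
  | n + 2, A => ∃ B : ℕ → Set X, (∀ i, BoldSigma (n + 1) (B i)ᶜ) ∧ A = ⋃ i, B i

/-- `A` is a boldface `Π⁰ₙ` subset of `X`: its complement is boldface `Σ⁰ₙ`. -/
def BoldPi {X : Type*} [TopologicalSpace X] (n : ℕ) (A : Set X) : Prop :=
  BoldSigma n Aᶜ

/-- A subset `A` of `Y` is boldface `Σ⁰ₙ`-complete if it is boldface `Σ⁰ₙ` and every boldface `Σ⁰ₙ`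
subset of every zero-dimensional Polish space is a preimage of `A` under a continuous map. -/
def BoldSigmaComplete {Y : Type v} [TopologicalSpace Y] (n : ℕ) (A : Set Y) : Prop :=
  BoldSigma n A ∧
    ∀ (X : Type u) [TopologicalSpace X] [PolishSpace X],
      TopologicalSpace.IsTopologicalBasis {s : Set X | IsClopen s} →
      ∀ B : Set X, BoldSigma n B → ∃ f : X → Y, Continuous f ∧ f ⁻¹' A = B

/-! Everything follows from one continuous reduction. By `BoldSigma.exists_continuous_infinite_row`,
a `Σ⁰₃` set in a zero-dimensional space reduces to the matrices `w` with an infinite row. Fix a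
noncomputable `r`. A finite-injury construction turns `w` continuously into a real `y = stageLimit r
w` that computes `r` if and only if `w` has an infinite row: each `true` of `w` writes a piece of
`r` into the same row of `y`, while functional number `e` is diagonalized against `r` at most once,
without touching the rows below `e`. An infinite row thus remains readable from some point on. If
all rows are finite and functional `e` computed `r` from `y`, then every hit on a string that is
blank in the rows below `e` beyond a finite part would be correct, and `r` would be computable.
Since `r ⊕ y ≡ y` if and only if `r ≤ y`, this gives hardness.

The upper bound `Σ⁰₃` is a count of quantifiers over codes. A diagonal set that is `Σ⁰₃` but not
`Π⁰₃` transfers along the reduction, so `≡_T` is not `Π⁰₃`. Finally, a Baire category argument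
(`IsLearnable.boldSigma_two`) makes a learnable relation with countable classes `Σ⁰₂`, hence `Π⁰₃`,
so `≡_T` is not learnable. -/

/-- The initial segment of length `s` of a real. -/
def CantorSeq.initSeg (y : CantorSeq) (s : ℕ) : List Bool := (List.range s).map y

namespace CantorSeq

@[simp] theorem length_initSeg (y : CantorSeq) (s : ℕ) : (y.initSeg s).length = s := by
  simp [initSeg]

theorem initSeg_getElem? (y : CantorSeq) {s n : ℕ} (h : n < s) :
    (y.initSeg s)[n]? = some (y n) := by
  simp [initSeg, h]

theorem initSeg_succ (y : CantorSeq) (s : ℕ) : y.initSeg (s + 1) = y.initSeg s ++ [y s] := by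
  simp [initSeg, List.range_succ]

theorem initSeg_prefix (y : CantorSeq) {s t : ℕ} (h : s ≤ t) : y.initSeg s <+: y.initSeg t := by
  induction t, h using Nat.le_induction with
  | base => exact List.prefix_rfl
  | succ t _ ih => exact ih.trans (by rw [initSeg_succ]; exact List.prefix_append _ _)

theorem take_initSeg (y : CantorSeq) {s t : ℕ} (h : t ≤ s) :
    (y.initSeg s).take t = y.initSeg t := by
  rw [List.prefix_iff_eq_take.1 (y.initSeg_prefix h), length_initSeg]

end CantorSeq

/-! ### The use principle: oracle computations as monotone operators on strings -/

theorem Nat.mem_rfind_decide_eq_zero {h : ℕ → Part ℕ} {v : ℕ} :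
    v ∈ Nat.rfind (fun n => (fun m => decide (m = 0)) <$> h n) ↔
      0 ∈ h v ∧ ∀ m < v, ∃ u, u ∈ h m ∧ u ≠ 0 := by
  refine Nat.mem_rfind.trans ?_
  simp only [Part.map_eq_map, Part.mem_map_iff, decide_eq_true_eq, decide_eq_false_iff_not,
    exists_eq_right]

/-- A partial recursive operator on strings that is monotone in the oracle string and computes `f`
along the initial segments of `y`. -/
structure ComputesAlong (y : CantorSeq) (f : ℕ → Part ℕ) (F : List Bool → ℕ → Part ℕ) : Prop where
  partrec : Partrec₂ fun σ n => F σ n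
  mono : ∀ ⦃σ τ : List Bool⦄, σ <+: τ → ∀ ⦃n v : ℕ⦄, v ∈ F σ n → v ∈ F τ n
  mem_iff : ∀ n v : ℕ, v ∈ f n ↔ ∃ t, v ∈ F (y.initSeg t) n

namespace ComputesAlong

variable {y : CantorSeq} {f g : ℕ → Part ℕ} {F G : List Bool → ℕ → Part ℕ}

theorem mono_le (hF : ComputesAlong y f F) {s t n v : ℕ} (h : s ≤ t)
    (hv : v ∈ F (y.initSeg s) n) : v ∈ F (y.initSeg t) n :=
  hF.mono (y.initSeg_prefix h) hv

theorem of_partrec (hf : Nat.Partrec f) : ComputesAlong y f fun _ => f where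
  partrec := (Partrec.nat_iff.2 hf).comp Computable.snd
  mono := fun _ _ _ _ _ h => h
  mem_iff := by simp

theorem oracle : ComputesAlong y y.charFun
    fun σ n => ((σ[n]?.map Bool.toNat : Option ℕ) : Part ℕ) where
  partrec := by
    refine Computable.ofOption ?_
    exact Computable.option_map Computable.list_getElem?
      ((Primrec.dom_finite Bool.toNat).to_comp.comp Computable.snd).to₂
  mono := by
    rintro σ _ ⟨τ, rfl⟩ n v
    simp only [Part.mem_ofOption, Option.mem_def, Option.map_eq_some_iff]
    rintro ⟨b, hb, rfl⟩
    exact ⟨b, by rw [List.getElem?_append_left (List.getElem?_eq_some_iff.1 hb).1, hb], rfl⟩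
  mem_iff := by
    intro n v
    simp only [CantorSeq.charFun, Part.mem_some_iff, Part.mem_ofOption, Option.mem_def,
      Option.map_eq_some_iff]
    constructor
    · rintro rfl
      exact ⟨n + 1, y n, y.initSeg_getElem? n.lt_succ_self, rfl⟩
    · rintro ⟨t, b, hb, rfl⟩
      have ht : n < t := by
        have := (List.getElem?_eq_some_iff.1 hb).1
        simpa using this
      rw [y.initSeg_getElem? ht] at hb
      cases hb; rfl

/-- Each computation uses a finite part of `y`; by monotonicity the longer of the two serves both.
-/
theorem comp (hF : ComputesAlong y f F) (hG : ComputesAlong y g G) :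
    ComputesAlong y (fun n => (g n).bind f) fun σ n => (G σ n).bind (F σ) where
  partrec := Partrec.bind hG.partrec
    (hF.partrec.comp (Computable.fst.comp Computable.fst) Computable.snd)
  mono := by
    intro σ τ h n v
    simp only [Part.mem_bind_iff]
    rintro ⟨u, hu, hv⟩
    exact ⟨u, hG.mono h hu, hF.mono h hv⟩
  mem_iff := by
    intro n v
    simp only [Part.mem_bind_iff, hF.mem_iff, hG.mem_iff]
    constructor
    · rintro ⟨u, ⟨s, hs⟩, t, ht⟩
      exact ⟨max s t, u, hG.mono_le (le_max_left s t) hs, hF.mono_le (le_max_right s t) ht⟩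
    · rintro ⟨t, u, hu, hv⟩
      exact ⟨u, ⟨t, hu⟩, t, hv⟩

theorem pair (hF : ComputesAlong y f F) (hG : ComputesAlong y g G) :
    ComputesAlong y (fun n => Nat.pair <$> f n <*> g n)
      fun σ n => (F σ n).bind fun a => (G σ n).map (Nat.pair a) where
  partrec := Partrec.bind hF.partrec <| Partrec.map
    (hG.partrec.comp (Computable.fst.comp Computable.fst) (Computable.snd.comp Computable.fst))
    (Primrec₂.natPair.to_comp.comp (Computable.snd.comp Computable.fst) Computable.snd)
  mono := by
    intro σ τ h n v
    simp only [Part.mem_bind_iff, Part.mem_map_iff]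
    rintro ⟨a, ha, b, hb, rfl⟩
    exact ⟨a, hF.mono h ha, b, hG.mono h hb, rfl⟩
  mem_iff := by
    intro n v
    simp only [Seq.seq, Part.map_eq_map, Part.mem_bind_iff, Part.mem_map_iff, hF.mem_iff,
      hG.mem_iff]
    constructor
    · rintro ⟨_, ⟨a, ⟨s, hs⟩, rfl⟩, b, ⟨t, ht⟩, rfl⟩
      exact ⟨max s t, a, hF.mono_le (le_max_left s t) hs, b,
        hG.mono_le (le_max_right s t) ht, rfl⟩
    · rintro ⟨t, a, ha, b, hb, rfl⟩
      exact ⟨_, ⟨a, ⟨t, ha⟩, rfl⟩, b, ⟨t, hb⟩, rfl⟩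

theorem prec (hF : ComputesAlong y f F) (hG : ComputesAlong y g G) :
    ComputesAlong y
      (fun p => p.unpair.2.rec (f p.unpair.1) fun k IH =>
        IH.bind fun i => g (Nat.pair p.unpair.1 (Nat.pair k i)))
      fun σ p => p.unpair.2.rec (F σ p.unpair.1) fun k IH =>
        IH.bind fun i => G σ (Nat.pair p.unpair.1 (Nat.pair k i)) where
  partrec := by
    refine Partrec.nat_rec (f := fun p : List Bool × ℕ => p.2.unpair.2)
      (g := fun p : List Bool × ℕ => F p.1 p.2.unpair.1)
      (h := fun p q => G p.1 (Nat.pair p.2.unpair.1 (Nat.pair q.1 q.2)))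
      (Computable.snd.comp (Computable.unpair.comp Computable.snd))
      (hF.partrec.comp Computable.fst
        (Computable.fst.comp (Computable.unpair.comp Computable.snd))) ?_
    exact hG.partrec.comp (Computable.fst.comp Computable.fst)
      (Primrec₂.natPair.to_comp.comp
        (Computable.fst.comp (Computable.unpair.comp (Computable.snd.comp Computable.fst)))
        (Primrec₂.natPair.to_comp.comp (Computable.fst.comp Computable.snd)
          (Computable.snd.comp Computable.snd)))
  mono := by
    intro σ τ h p
    induction p.unpair.2 with
    | zero => exact fun v hv => hF.mono h hv
    | succ k ih =>
      intro v hv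
      obtain ⟨i, hi, hv⟩ := Part.mem_bind_iff.1 hv
      exact Part.mem_bind_iff.2 ⟨i, ih hi, hG.mono h hv⟩
  mem_iff := by
    intro p
    -- The induction needs monotonicity at every recursion depth `m`, not only at `p.unpair.2`.
    have mono : ∀ (m : ℕ) {σ τ : List Bool}, σ <+: τ → ∀ v : ℕ,
        v ∈ (Nat.rec (F σ p.unpair.1) (fun k IH =>
          IH.bind fun i => G σ (Nat.pair p.unpair.1 (Nat.pair k i))) m : Part ℕ) →
        v ∈ (Nat.rec (F τ p.unpair.1) (fun k IH =>
          IH.bind fun i => G τ (Nat.pair p.unpair.1 (Nat.pair k i))) m : Part ℕ) := by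
      intro m σ τ h
      induction m with
      | zero => exact fun v hv => hF.mono h hv
      | succ k ih =>
        intro v hv
        obtain ⟨i, hi, hv⟩ := Part.mem_bind_iff.1 hv
        exact Part.mem_bind_iff.2 ⟨i, ih _ hi, hG.mono h hv⟩
    induction p.unpair.2 with
    | zero => exact fun v => hF.mem_iff _ v
    | succ k ih =>
      intro v
      simp only [Part.mem_bind_iff, ih, hG.mem_iff]
      constructor
      · rintro ⟨i, ⟨s, hs⟩, t, ht⟩
        exact ⟨max s t, i, mono k (y.initSeg_prefix (le_max_left s t)) _ hs,
          hG.mono_le (le_max_right s t) ht⟩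
      · rintro ⟨t, i, hi, hv⟩
        exact ⟨i, ⟨t, hi⟩, t, hv⟩

theorem rfind (hF : ComputesAlong y f F) :
    ComputesAlong y
      (fun a => Nat.rfind fun n => (fun m => decide (m = 0)) <$> f (Nat.pair a n))
      fun σ a => Nat.rfind fun n => (fun m => decide (m = 0)) <$> F σ (Nat.pair a n) where
  partrec := by
    refine Partrec.rfind (p := fun (p : List Bool × ℕ) n =>
      (fun m => decide (m = 0)) <$> F p.1 (Nat.pair p.2 n)) ?_
    refine Partrec.map (hF.partrec.comp (Computable.fst.comp Computable.fst)
      (Primrec₂.natPair.to_comp.comp (Computable.snd.comp Computable.fst) Computable.snd)) ?_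
    exact (Primrec.eq.decide.comp Primrec.snd (Primrec.const 0)).to_comp
  mono := by
    intro σ τ h a v hv
    rw [Nat.mem_rfind_decide_eq_zero] at hv ⊢
    refine ⟨hF.mono h hv.1, fun m hm => ?_⟩
    obtain ⟨u, hu, hu0⟩ := hv.2 m hm
    exact ⟨u, hF.mono h hu, hu0⟩
  mem_iff := by
    intro a v
    simp_rw [Nat.mem_rfind_decide_eq_zero, hF.mem_iff]
    constructor
    · rintro ⟨⟨s, hs⟩, hlt⟩
      have : ∀ m, ∃ t, m < v → ∃ u, u ∈ F (y.initSeg t) (Nat.pair a m) ∧ u ≠ 0 := by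
        intro m
        by_cases hm : m < v
        · obtain ⟨u, ⟨t, ht⟩, hu0⟩ := hlt m hm
          exact ⟨t, fun _ => ⟨u, ht, hu0⟩⟩
        · exact ⟨0, fun h => absurd h hm⟩
      choose t ht using this
      refine ⟨max s ((Finset.range v).sup t), hF.mono_le (le_max_left _ _) hs, fun m hm => ?_⟩
      obtain ⟨u, hu, hu0⟩ := ht m hm
      exact ⟨u, hF.mono_le ((Finset.le_sup (f := t) (Finset.mem_range.2 hm)).trans
        (le_max_right _ _)) hu, hu0⟩
    · rintro ⟨t, hv, hlt⟩
      refine ⟨⟨t, hv⟩, fun m hm => ?_⟩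
      obtain ⟨u, hu, hu0⟩ := hlt m hm
      exact ⟨u, ⟨t, hu⟩, hu0⟩

end ComputesAlong

theorem Nat.RecursiveIn.exists_computesAlong {y : CantorSeq} {f : ℕ →. ℕ}
    (hf : Nat.RecursiveIn {y.charFun} f) : ∃ F, ComputesAlong y f F := by
  induction hf with
  | zero => exact ⟨_, .of_partrec .zero⟩
  | succ => exact ⟨_, .of_partrec .succ⟩
  | left => exact ⟨_, .of_partrec .left⟩
  | right => exact ⟨_, .of_partrec .right⟩
  | oracle g hg => rw [Set.mem_singleton_iff.1 hg]; exact ⟨_, .oracle⟩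
  | pair _ _ ihf ihg =>
    obtain ⟨F, hF⟩ := ihf
    obtain ⟨G, hG⟩ := ihg
    exact ⟨_, hF.pair hG⟩
  | comp _ _ ihf ihg =>
    obtain ⟨F, hF⟩ := ihf
    obtain ⟨G, hG⟩ := ihg
    exact ⟨_, hF.comp hG⟩
  | prec _ _ ihf ihg =>
    obtain ⟨F, hF⟩ := ihf
    obtain ⟨G, hG⟩ := ihg
    exact ⟨_, hF.prec hG⟩
  | rfind _ ihf =>
    obtain ⟨F, hF⟩ := ihf
    exact ⟨_, hF.rfind⟩

/-! ### Turing reducibility as a search through initial segments -/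

open Nat.Partrec (Code)

/-- A function recursive in `y` is enumerated, by some code, along the initial segments of `y`. -/
theorem Nat.RecursiveIn.exists_code {y : CantorSeq} {f : ℕ →. ℕ}
    (hf : Nat.RecursiveIn {y.charFun} f) :
    ∃ c : Code, ∀ n v, v ∈ f n ↔ ∃ t, v ∈ c.eval (Encodable.encode (y.initSeg t, n)) := by
  obtain ⟨F, hF⟩ := hf.exists_computesAlong
  obtain ⟨c, hc⟩ := Code.exists_code.1 hF.partrec
  refine ⟨c, fun n v => ?_⟩
  rw [hF.mem_iff, hc]
  simp

/-- The function reading off the bit number `h n` of the oracle is recursive in the oracle. -/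
theorem CantorSeq.recursiveIn_comp (y : CantorSeq) {h : ℕ → ℕ} (hh : Computable h) :
    Nat.RecursiveIn {y.charFun} fun n => Part.some (y (h n)).toNat :=
  ((Nat.RecursiveIn.oracle y.charFun (Set.mem_singleton _)).comp
    (Partrec.nat_iff.1 hh).recursiveIn).of_eq fun _ => Part.bind_some _ _

theorem CantorSeq.recursiveIn_encode_initSeg (y : CantorSeq) :
    Nat.RecursiveIn {y.charFun} fun s => Part.some (Encodable.encode (y.initSeg s)) := by
  -- Appends one bit to a coded string; the default `[]` is never reached on codes of initial
  -- segments.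
  let app : ℕ → ℕ := fun p => Encodable.encode
    (((Encodable.decode p.unpair.1 : Option (List Bool)).getD []) ++ [decide (p.unpair.2 = 1)])
  have happ : Nat.RecursiveIn {y.charFun} fun p => Part.some (app p) := by
    refine Nat.Primrec.recursiveIn (Primrec.nat_iff.1 ?_)
    refine Primrec.encode.comp (Primrec.list_append.comp
      (Primrec.option_getD.comp (Primrec.decode.comp (Primrec.fst.comp Primrec.unpair))
        (Primrec.const []))
      (Primrec.list_cons.comp ?_ (Primrec.const [])))
    exact Primrec.eq.decide.comp (Primrec.snd.comp Primrec.unpair) (Primrec.const 1)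
  have hpr : ∀ f : ℕ → ℕ, Primrec f → Nat.RecursiveIn {y.charFun} fun p => Part.some (f p) :=
    fun f hf => Nat.Primrec.recursiveIn (Primrec.nat_iff.1 hf)
  have step : Nat.RecursiveIn {y.charFun} fun p => Part.some
      (app (Nat.pair p.unpair.2.unpair.2 (y p.unpair.2.unpair.1).toNat)) := by
    refine (happ.comp ((hpr _ (Primrec.snd.comp (Primrec.unpair.comp
      (Primrec.snd.comp Primrec.unpair)))).pair
      (y.recursiveIn_comp (Primrec.fst.comp (Primrec.unpair.comp
      (Primrec.snd.comp Primrec.unpair))).to_comp))).of_eq fun p => ?_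
    simp [Seq.seq]
  refine (((hpr (fun _ => Encodable.encode ([] : List Bool)) (Primrec.const _)).prec step).comp
    (hpr (fun s => Nat.pair 0 s) (Primrec₂.natPair.comp (Primrec.const 0) Primrec.id))).of_eq
    fun s => ?_
  simp only [Part.bind_eq_bind, Part.bind_some, Nat.unpair_pair]
  induction s with
  | zero => simp [CantorSeq.initSeg]
  | succ s ih =>
    refine (congrArg (fun q : Part ℕ => q.bind _) ih).trans ?_
    rw [Part.bind_some, CantorSeq.initSeg_succ]
    cases y s <;> simp [app]

/-- A total function found by a computable search through the initial segments of `y` is recursive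
in `y`. -/
theorem CantorSeq.recursiveIn_of_mem_rfindOpt {y : CantorSeq} {H : List Bool → ℕ → Option ℕ}
    (hH : Computable₂ H) {g : ℕ → ℕ}
    (hg : ∀ n, g n ∈ Nat.rfindOpt fun s => H (y.initSeg s) n) :
    Nat.RecursiveIn {y.charFun} fun n => Part.some (g n) := by
  let P : ℕ → ℕ := fun p => Encodable.encode
    (H ((Encodable.decode p.unpair.2 : Option (List Bool)).getD []) p.unpair.1)
  have hP : Computable P := Computable.encode.comp (hH.comp
    (Computable.option_getD (Computable.decode.comp (Computable.snd.comp Computable.unpair))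
      (Computable.const []))
    (Computable.fst.comp Computable.unpair))
  have hc : ∀ f : ℕ → ℕ, Computable f → Nat.RecursiveIn {y.charFun} fun p => Part.some (f p) :=
    fun f hf => (Partrec.nat_iff.1 hf).recursiveIn
  have hE : Nat.RecursiveIn {y.charFun} fun p => Part.some
      (P (Nat.pair p.unpair.1 (Encodable.encode (y.initSeg p.unpair.2)))) := by
    refine ((hc _ hP).comp ((hc _ (Computable.fst.comp Computable.unpair)).pair
      (y.recursiveIn_encode_initSeg.comp
        (hc _ (Computable.snd.comp Computable.unpair))))).of_eq fun p => ?_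
    simp [Seq.seq]
  -- `none` is encoded as `0` and `some v` as `v + 1`, so `1 - m` vanishes exactly at a success;
  -- `Nat.pred` then strips the successor.
  have hsearch := ((hc (fun m => 1 - m) (Primrec.nat_sub.comp (Primrec.const 1)
    Primrec.id).to_comp).comp hE).rfind
  refine ((hc Nat.pred Computable.pred).comp (hE.comp ((hc id Computable.id).pair
    hsearch))).of_eq_tot fun n => ?_
  obtain ⟨s, hs, hv⟩ := Part.mem_bind_iff.1 (hg n)
  have hv : H (y.initSeg s) n = some (g n) := by simpa using hv
  have hs' := Nat.mem_rfind.1 hs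
  have key : s ∈ Nat.rfind (fun k => (fun m => decide (m = 0)) <$>
      (Part.some (P (Nat.pair (Nat.pair n k).unpair.1
        (Encodable.encode (y.initSeg (Nat.pair n k).unpair.2)))) >>= fun m => Part.some (1 - m))) := by
    rw [Nat.mem_rfind_decide_eq_zero]
    refine ⟨by simp [P, hv], fun m hm => ?_⟩
    have := hs'.2 hm
    have : H (y.initSeg m) n = none := by
      have h : false = (H (y.initSeg m) n).isSome := Part.mem_some_iff.1 this
      simpa using h.symm
    simp [P, this]
  simp only [Part.bind_eq_bind, Part.mem_bind_iff]
  refine ⟨g n + 1, ⟨Nat.pair n s, ?_, ?_⟩, ?_⟩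
  · simp only [Seq.seq, Part.map_eq_map, Part.mem_bind_iff, Part.mem_map_iff]
    exact ⟨Nat.pair n, ⟨n, by simp, rfl⟩, s, key, rfl⟩
  · simp [P, hv]
  · simp

theorem CantorSeq.recursiveIn_of_search {y : CantorSeq} {H : List Bool → ℕ → Option ℕ}
    (hH : Computable₂ H) {g : ℕ → ℕ} (sound : ∀ n s v, v ∈ H (y.initSeg s) n → v = g n)
    (complete : ∀ n, ∃ s, (H (y.initSeg s) n).isSome) :
    Nat.RecursiveIn {y.charFun} fun n => Part.some (g n) := by
  refine CantorSeq.recursiveIn_of_mem_rfindOpt hH fun n => ?_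
  obtain ⟨s, hs⟩ := complete n
  have hdom : (Nat.rfindOpt fun s => H (y.initSeg s) n).Dom :=
    Nat.rfindOpt_dom.2 ⟨s, _, Option.get_mem hs⟩
  obtain ⟨t, ht⟩ := Nat.rfindOpt_spec (Part.get_mem hdom)
  exact sound n t _ ht ▸ Part.get_mem hdom

namespace Nat.Partrec.Code

/-- One step of the search for a value of the functional `c` at `n`: run `c` on `n` together with an
initial segment of the oracle string `σ`; the length of `σ` determines this initial segment and the
number of steps. -/
def runOn (c : Code) (σ : List Bool) (n : ℕ) : Option ℕ :=
  evaln σ.length.unpair.2 c (Encodable.encode (σ.take σ.length.unpair.1, n))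

theorem computable_runOn (c : Code) : Computable₂ c.runOn := by
  have h : Primrec fun p : List Bool × ℕ => p.1.length.unpair :=
    Primrec.unpair.comp (Primrec.list_length.comp Primrec.fst)
  have h₁ : Primrec fun p : List Bool × ℕ => (p.1.length.unpair.2, c) :=
    (Primrec.snd.comp h).pair (_root_.Primrec.const c)
  have h₂ : Primrec fun p : List Bool × ℕ => Encodable.encode (p.1.take p.1.length.unpair.1, p.2) :=
    Primrec.encode.comp ((Primrec.list_take.comp (Primrec.fst.comp h) Primrec.fst).pair Primrec.snd)
  exact (primrec_evaln.comp (h₁.pair h₂)).to_comp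

/-- A function recursive in `y` comes with a sound and complete search through the initial segments
of `y`. -/
theorem exists_runOn {y : CantorSeq} {f : ℕ → ℕ}
    (hf : Nat.RecursiveIn {y.charFun} fun n => Part.some (f n)) : ∃ c : Code,
      (∀ n s v, v ∈ c.runOn (y.initSeg s) n → v = f n) ∧
      ∀ n, ∃ s, f n ∈ c.runOn (y.initSeg s) n := by
  obtain ⟨c, hc⟩ := hf.exists_code
  refine ⟨c, fun n s v hv => ?_, fun n => ?_⟩
  · have hv := evaln_sound hv
    rw [y.take_initSeg (by simpa using Nat.unpair_left_le s)] at hv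
    simpa using (hc n v).2 ⟨_, hv⟩
  · obtain ⟨t, ht⟩ := (hc n (f n)).1 (Part.mem_some _)
    obtain ⟨k, hk⟩ := evaln_complete.1 ht
    -- A string of this length makes `runOn` use the prefix of length `t` and `k` steps.
    refine ⟨Nat.pair t k, ?_⟩
    simpa [runOn, y.take_initSeg (Nat.left_le_pair t k)] using hk

end Nat.Partrec.Code

/-- The only unbounded choice is that of a code, from a countable type. This gives both the `Σ⁰₃`
bound and the countability of the classes. -/
theorem turingReducible_charFun_iff {x y : CantorSeq} : TuringReducible x.charFun y.charFun ↔
    ∃ c : Code, ∀ n, (x n).toNat ∈ Nat.rfindOpt fun s => c.runOn (y.initSeg s) n := by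
  rw [TuringReducible, RecursiveIn.iff_nat]
  constructor
  · intro h
    obtain ⟨c, sound, complete⟩ := Code.exists_runOn h
    refine ⟨c, fun n => ?_⟩
    obtain ⟨s, hs⟩ := complete n
    have hdom : (Nat.rfindOpt fun s => c.runOn (y.initSeg s) n).Dom :=
      Nat.rfindOpt_dom.2 ⟨s, _, hs⟩
    obtain ⟨t, ht⟩ := Nat.rfindOpt_spec (Part.get_mem hdom)
    exact sound n t _ ht ▸ Part.get_mem hdom
  · rintro ⟨c, hc⟩
    exact CantorSeq.recursiveIn_of_mem_rfindOpt c.computable_runOn hc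

/-- The join of two reals. -/
def CantorSeq.join (x y : CantorSeq) : CantorSeq := fun n =>
  if n % 2 = 0 then x (n / 2) else y (n / 2)

/-- Turns a reducibility question into an equivalence question. The join computes both halves;
conversely `y` supplies the odd bits itself and the even ones by the search for `r`. -/
theorem turingEquivReal_join_iff {r y : CantorSeq} :
    TuringEquivReal (r.join y) y ↔ TuringReducible r.charFun y.charFun := by
  have hr : TuringReducible r.charFun (r.join y).charFun := by
    rw [TuringReducible, RecursiveIn.iff_nat]
    refine ((r.join y).recursiveIn_comp (h := fun n => 2 * n)
      (Primrec.nat_mul.comp (Primrec.const 2) Primrec.id).to_comp).of_eq fun n => ?_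
    simp [CantorSeq.join, CantorSeq.charFun]
  have hy : TuringReducible y.charFun (r.join y).charFun := by
    rw [TuringReducible, RecursiveIn.iff_nat]
    refine ((r.join y).recursiveIn_comp (h := fun n => 2 * n + 1)
      (Primrec.succ.comp (Primrec.nat_mul.comp (Primrec.const 2) Primrec.id)).to_comp).of_eq
      fun n => ?_
    have : (2 * n + 1) / 2 = n := by omega
    simp [CantorSeq.join, CantorSeq.charFun, this]
  refine ⟨fun h => hr.trans h.1, fun h => ⟨?_, hy⟩⟩
  rw [TuringReducible, RecursiveIn.iff_nat] at h ⊢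
  obtain ⟨c, sound, complete⟩ := Code.exists_runOn h
  let H : List Bool → ℕ → Option ℕ := fun σ n =>
    if n % 2 = 0 then c.runOn σ (n / 2) else σ[n / 2]?.map Bool.toNat
  have hdiv : Computable fun p : List Bool × ℕ => p.2 / 2 :=
    (Primrec.nat_div.comp Primrec.snd (Primrec.const 2)).to_comp
  have hH : Computable₂ H := by
    refine (Computable.cond (c := fun p : List Bool × ℕ => decide (p.2 % 2 = 0))
      (Primrec.eq.decide.comp (Primrec.nat_mod.comp Primrec.snd (Primrec.const 2))
        (Primrec.const 0)).to_comp
      (c.computable_runOn.comp Computable.fst hdiv)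
      (Computable.option_map (Computable.list_getElem?.comp Computable.fst hdiv)
        ((Primrec.dom_finite Bool.toNat).to_comp.comp Computable.snd).to₂)).of_eq ?_
    rintro ⟨σ, n⟩
    by_cases hn : n % 2 = 0 <;> simp [H, hn]
  refine CantorSeq.recursiveIn_of_search hH (g := fun n => (r.join y n).toNat) ?_ ?_
  · intro n s v hv
    by_cases hn : n % 2 = 0
    · simp only [H, hn, if_true] at hv
      simpa [CantorSeq.join, hn] using sound _ _ _ hv
    · simp only [H, hn, if_false, Option.mem_def, Option.map_eq_some_iff] at hv
      obtain ⟨b, hb, rfl⟩ := hv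
      have hs : n / 2 < s := by simpa using (List.getElem?_eq_some_iff.1 hb).1
      rw [y.initSeg_getElem? hs] at hb
      cases hb
      simp [CantorSeq.join, hn]
  · intro n
    by_cases hn : n % 2 = 0
    · obtain ⟨s, hs⟩ := complete (n / 2)
      exact ⟨s, by simp only [H, hn, if_true]; exact Option.isSome_of_mem hs⟩
    · exact ⟨n / 2 + 1, by simp [H, hn]⟩

/-! ### Boldface `Σ⁰₃` sets: infinite rows and diagonalization -/

open Set Filter Topology TopologicalSpace

theorem TopologicalSpace.exists_seq_isTopologicalBasis (X : Type*) [TopologicalSpace X]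
    [SecondCountableTopology X] [Nonempty X] :
    ∃ b : ℕ → Set X, IsTopologicalBasis (range b) ∧ ∀ n, (b n).Nonempty := by
  have hne : (countableBasis X).Nonempty := by
    obtain ⟨s, hs, -⟩ := (isBasis_countableBasis X).exists_subset_of_mem_open
      (mem_univ (Classical.arbitrary X)) isOpen_univ
    exact ⟨s, hs⟩
  obtain ⟨b, hb⟩ := (countable_countableBasis X).exists_eq_range hne
  exact ⟨b, hb ▸ isBasis_countableBasis X, fun n =>
    nonempty_of_mem_countableBasis (hb ▸ mem_range_self n)⟩

theorem IsOpen.exists_disjoint_clopen_iUnion {X : Type*} [TopologicalSpace X]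
    [SecondCountableTopology X] (hX : IsTopologicalBasis {s : Set X | IsClopen s}) {U : Set X}
    (hU : IsOpen U) :
    ∃ K : ℕ → Set X, (∀ n, IsClopen (K n)) ∧ Pairwise (Function.onFun Disjoint K) ∧
      U = ⋃ n, K n := by
  obtain ⟨S, hS, rfl⟩ := hX.open_eq_sUnion hU
  obtain ⟨T, hT, hTS, hTU⟩ := isOpen_sUnion_countable S fun s hs => (hS hs).isOpen
  -- Inserting `∅` makes the family nonempty, so that it can be enumerated.
  obtain ⟨K, hK⟩ := (hT.insert ∅).exists_eq_range (insert_nonempty _ _)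
  have hKc : ∀ n, IsClopen (K n) := by
    intro n
    have : K n ∈ insert ∅ T := hK ▸ mem_range_self n
    rcases this with h | h
    · rw [h]; exact isClopen_empty
    · exact hS (hTS h)
  refine ⟨disjointed K, fun n => ?_, disjoint_disjointed K, ?_⟩
  · exact disjointedRec (fun _ i ht => ht.diff (hKc i)) (hKc n)
  · rw [iUnion_disjointed, ← sUnion_range, ← hK, sUnion_insert, empty_union, hTU]

theorem BoldSigma.preimage {X Y : Type*} [TopologicalSpace X] [TopologicalSpace Y] {f : X → Y}
    (hf : Continuous f) : ∀ {n : ℕ} {A : Set Y}, BoldSigma n A → BoldSigma n (f ⁻¹' A)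
  | 0, _, h => h.elim
  | 1, _, h => IsOpen.preimage hf h
  | n + 2, _, ⟨B, hB, hA⟩ =>
    ⟨fun i => f ⁻¹' B i, fun i => BoldSigma.preimage hf (hB i), by rw [hA, preimage_iUnion]⟩

theorem BoldSigma.boldPi_succ {X : Type*} [TopologicalSpace X] {n : ℕ} {A : Set X}
    (hA : BoldSigma (n + 1) A) : BoldPi (n + 2) A :=
  ⟨fun _ => Aᶜ, fun _ => by rwa [compl_compl], (iUnion_const _).symm⟩

theorem boldSigma_three_iUnion_iInter {X : Type*} [TopologicalSpace X] {O : ℕ → ℕ → Set X}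
    (hO : ∀ i j, IsOpen (O i j)) : BoldSigma 3 (⋃ i, ⋂ j, O i j) :=
  ⟨fun i => ⋂ j, O i j, fun i => ⟨fun j => (O i j)ᶜ, fun j => by
    rw [compl_compl]; exact hO i j, compl_iInter _⟩, rfl⟩

theorem BoldSigma.exists_iUnion_iInter {X : Type*} [TopologicalSpace X] {A : Set X}
    (hA : BoldSigma 3 A) : ∃ O : ℕ → ℕ → Set X, (∀ i j, IsOpen (O i j)) ∧ A = ⋃ i, ⋂ j, O i j := by
  obtain ⟨B, hB, rfl⟩ := hA
  choose C hC hBC using hB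
  exact ⟨fun i j => (C i j)ᶜ, hC, iUnion_congr fun i => by
    rw [← compl_iUnion, ← hBC, compl_compl]⟩

/-- Every boldface `Σ⁰₃` set of a zero-dimensional second countable space is continuously reducible
to the set of matrices with an infinite row. -/
theorem BoldSigma.exists_continuous_infinite_row {X : Type*} [TopologicalSpace X]
    [SecondCountableTopology X] (hX : IsTopologicalBasis {s : Set X | IsClopen s}) {B : Set X}
    (hB : BoldSigma 3 B) :
    ∃ w : X → CantorSeq, Continuous w ∧
      ∀ z, z ∈ B ↔ ∃ i, {j | w z (Nat.pair i j) = true}.Infinite := by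
  classical
  obtain ⟨O, hO, rfl⟩ := hB.exists_iUnion_iInter
  -- These sets decrease in `j`. Once each is split into disjoint clopen pieces, row `i` of `w z`
  -- has exactly one `true` for every `j` whose set contains `z`.
  have hD : ∀ i j, IsOpen (⋂ k ∈ Iic j, O i k) := fun i j =>
    (finite_Iic j).isOpen_biInter fun k _ => hO i k
  choose K hK hKd hKU using fun i j => (hD i j).exists_disjoint_clopen_iUnion hX
  let w : X → CantorSeq := fun z p =>
    decide (z ∈ K p.unpair.1 p.unpair.2.unpair.1 p.unpair.2.unpair.2)
  refine ⟨w, continuous_pi fun p => ?_, fun z => ?_⟩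
  · refine (continuous_bool_rng true).2 ?_
    have : (fun z => w z p) ⁻¹' {true} = K p.unpair.1 p.unpair.2.unpair.1 p.unpair.2.unpair.2 := by
      ext z; simp [w]
    rw [this]
    exact hK _ _ _
  · simp only [mem_iUnion]
    refine exists_congr fun i => ?_
    have hmem : ∀ j, (∃ m, z ∈ K i j m) ↔ ∀ k ≤ j, z ∈ O i k := fun j => by
      rw [← mem_iUnion, ← hKU]
      simp
    have hw : {j | w z (Nat.pair i j) = true} = {j | z ∈ K i j.unpair.1 j.unpair.2} := by
      simp [w]
    rw [hw]
    constructor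
    · intro hz
      rw [mem_iInter] at hz
      choose m hm using fun j => (hmem j).2 fun k _ => hz k
      refine Set.infinite_of_injective_forall_mem (f := fun j => Nat.pair j (m j)) ?_ ?_
      · intro a b hab
        exact (Nat.pair_eq_pair.1 hab).1
      · intro j
        simpa using hm j
    · intro hinf
      rw [mem_iInter]
      intro j
      by_contra hj
      -- If `z ∉ O i j`, only first coordinates up to `j` contribute, each at most once by
      -- disjointness.
      refine hinf (((finite_Iic j).biUnion
        (t := fun a => {p : ℕ | p.unpair.1 = a ∧ z ∈ K i a p.unpair.2}) fun a _ => ?_).subset ?_)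
      · refine Set.Subsingleton.finite ?_
        rintro p ⟨hp, hpz⟩ q ⟨hq, hqz⟩
        rw [← Nat.pair_unpair p, ← Nat.pair_unpair q, hp, hq]
        congr 1
        by_contra hne
        exact (hKd i a hne).le_bot ⟨hpz, hqz⟩
      · intro p hp
        simp only [mem_iUnion]
        refine ⟨p.unpair.1, ?_, rfl, hp⟩
        by_contra hlt
        exact hj ((hmem _).1 ⟨_, hp⟩ j (le_of_not_ge hlt))

/-- There is a boldface `Σ⁰₃` subset of Cantor space which is not boldface `Π⁰₃`. -/
theorem exists_boldSigma_three_not_boldPi_three :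
    ∃ D : Set CantorSeq, BoldSigma 3 D ∧ ¬ BoldPi 3 D := by
  obtain ⟨b, hb, -⟩ := exists_seq_isTopologicalBasis CantorSeq
  have hbo : ∀ n, IsOpen (b n) := fun n => hb.isOpen (mem_range_self n)
  have huniv : ∀ O : Set CantorSeq, IsOpen O → ∃ a : CantorSeq, O = ⋃ (n) (_ : a n = true), b n := by
    classical
    intro O hO
    obtain ⟨S, hS, rfl⟩ := hb.open_eq_sUnion hO
    refine ⟨fun n => decide (b n ∈ S), ?_⟩
    ext z
    simp only [mem_sUnion, mem_iUnion, decide_eq_true_eq, exists_prop]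
    constructor
    · rintro ⟨s, hs, hz⟩
      obtain ⟨n, rfl⟩ := hS hs
      exact ⟨n, hs, hz⟩
    · rintro ⟨n, hn, hz⟩
      exact ⟨_, hn, hz⟩
  -- A real codes a matrix of open sets; `D` consists of the reals that lie in the `Σ⁰₃` set they
  -- code.
  let O : ℕ → ℕ → Set CantorSeq := fun i j =>
    {a | ∃ n, a (Nat.pair i (Nat.pair j n)) = true ∧ a ∈ b n}
  refine ⟨⋃ i, ⋂ j, O i j, boldSigma_three_iUnion_iInter fun i j => ?_, fun h => ?_⟩
  · have : O i j = ⋃ n, (fun a : CantorSeq => a (Nat.pair i (Nat.pair j n))) ⁻¹' {true} ∩ b n := by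
      ext a; simp [O]
    rw [this]
    exact isOpen_iUnion fun n =>
      ((isOpen_discrete _).preimage (continuous_apply _)).inter (hbo n)
  · obtain ⟨U, hU, hUD⟩ := BoldSigma.exists_iUnion_iInter h
    choose a ha using fun i j => huniv (U i j) (hU i j)
    -- The real `d` codes the complement of `D`.
    let d : CantorSeq := fun p => a p.unpair.1 p.unpair.2.unpair.1 p.unpair.2.unpair.2
    have key : d ∈ ⋃ i, ⋂ j, U i j ↔ d ∈ ⋃ i, ⋂ j, O i j := by
      simp only [mem_iUnion, mem_iInter, ha, O, mem_ofPred_eq, d, Nat.unpair_pair, exists_prop]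
    rw [← hUD, mem_compl_iff] at key
    exact (iff_not_self key.symm).elim

/-! ### Learnability and Baire category -/

/-- A learnable equivalence relation with countable classes on a perfect second countable space `X` is
boldface `Σ⁰₂`, provided that `X^ℕ` is a Baire space. -/
theorem IsLearnable.boldSigma_two {X : Type*} [TopologicalSpace X]
    [SecondCountableTopology X] [T1Space X] [BaireSpace (ℕ → X)] [PerfectSpace X] [Nonempty X]
    {E : X → X → Prop} (hE : Equivalence E) (hcount : ∀ x, {y | E x y}.Countable)
    (hl : IsLearnable E) : BoldSigma 2 {p : X × X | E p.1 p.2} := by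
  obtain ⟨l, hlc, hl⟩ := hl
  obtain ⟨b, hb, hbne⟩ := exists_seq_isTopologicalBasis (ℕ → X)
  let cons : X → (ℕ → X) → ℕ → X := fun y v n => Nat.casesOn n y v
  have hcons : Continuous fun p : X × (ℕ → X) => cons p.1 p.2 := by
    refine continuous_pi fun n => ?_
    cases n with
    | zero => exact continuous_fst
    | succ n => exact (continuous_apply n).comp continuous_snd
  -- The learner is fed `y` followed by `v`. The claim is that `x E y` if and only if, for some `i`
  -- and `N`, all `v ∈ b i` make it answer `0` from `N` on.
  let C : ℕ → ℕ → Set (X × X) := fun i N =>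
    {p | ∀ v ∈ b i, ∀ n ≥ N, l n (cons p.2 v, p.1) = 0}
  have hcont : ∀ n, Continuous fun q : (X × X) × (ℕ → X) => l n (cons q.1.2 q.2, q.1.1) :=
    fun n => (hlc n).comp ((hcons.comp ((continuous_snd.comp continuous_fst).prodMk
      continuous_snd)).prodMk (continuous_fst.comp continuous_fst))
  have hC : ∀ i N, IsClosed (C i N) := by
    intro i N
    have : C i N = ⋂ v ∈ b i, ⋂ n ≥ N, (fun p : X × X => l n (cons p.2 v, p.1)) ⁻¹' {0} := by
      ext p; simp [C]
    rw [this]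
    exact isClosed_biInter fun v _ => isClosed_biInter fun n _ =>
      (isClosed_discrete _).preimage ((hcont n).comp (continuous_id.prodMk continuous_const))
  refine ⟨fun k => C k.unpair.1 k.unpair.2, fun k => (hC _ _).isOpen_compl, ?_⟩
  ext ⟨x, y⟩
  simp only [mem_ofPred_eq, mem_iUnion]
  constructor
  · intro hxy
    have : Countable {z | E x z} := (hcount x).to_subtype
    -- Countably many closed sets cover `X^ℕ`: either `v` meets the class of `x`, or `0` is the only
    -- possible correct limit. By Baire, one of them has interior.
    let F : (ℕ × {z | E x z}) ⊕ ℕ → Set (ℕ → X) := Sum.elim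
      (fun q => {v | v q.1 = q.2}) (fun N => {v | ∀ n ≥ N, l n (cons y v, x) = 0})
    have hFc : ∀ q, IsClosed (F q) := by
      rintro (⟨n, z⟩ | N)
      · exact isClosed_singleton.preimage (continuous_apply n)
      · have : F (Sum.inr N) = ⋂ n ≥ N, (fun v : ℕ → X => l n (cons y v, x)) ⁻¹' {0} := by
          ext v; simp [F]
        rw [this]
        exact isClosed_biInter fun n _ => (isClosed_discrete _).preimage
          ((hcont n).comp (f := fun v => ((x, y), v)) (continuous_const.prodMk continuous_id))
    have hFU : ⋃ q, F q = univ := by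
      refine eq_univ_of_forall fun v => mem_iUnion.2 ?_
      by_cases hv : ∃ n, E x (v n)
      · obtain ⟨n, hn⟩ := hv
        exact ⟨Sum.inl (n, ⟨v n, hn⟩), rfl⟩
      · obtain ⟨k, hk, hEk⟩ := hl (cons y v) x ⟨0, hxy⟩
        have hk0 : k = 0 := by
          cases k with
          | zero => rfl
          | succ k => exact (hv ⟨k, hEk⟩).elim
        rw [hk0, nhds_discrete, tendsto_pure, eventually_atTop] at hk
        obtain ⟨N, hN⟩ := hk
        exact ⟨Sum.inr N, hN⟩
    obtain ⟨q, u, hu⟩ := nonempty_interior_of_iUnion_of_closed hFc hFU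
    obtain ⟨s, hs, hus, hsF⟩ := hb.exists_subset_of_mem_open hu
      isOpen_interior
    have hsF := hsF.trans interior_subset
    obtain ⟨i, rfl⟩ := hs
    rcases q with ⟨n, z⟩ | N
    -- Fixing one coordinate leaves no interior, as points of a perfect space are not open.
    · exfalso
      have hcu : Continuous fun t : X => Function.update u n t :=
        continuous_const.update n continuous_id
      have hopen : IsOpen ((fun t : X => Function.update u n t) ⁻¹' b i) :=
        (hb.isOpen (mem_range_self i)).preimage hcu
      have hsub : (fun t : X => Function.update u n t) ⁻¹' b i ⊆ {(z : X)} := fun t ht => by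
        have : Function.update u n t n = z := hsF ht
        simpa using this
      have hne : u n ∈ (fun t : X => Function.update u n t) ⁻¹' b i := by
        simpa using hus
      have : (fun t : X => Function.update u n t) ⁻¹' b i = {(z : X)} :=
        hsub.antisymm (singleton_subset_iff.2 (hsub hne ▸ hne))
      exact not_isOpen_singleton (z : X) (this ▸ hopen)
    · refine ⟨Nat.pair i N, ?_⟩
      rw [Nat.unpair_pair]
      exact fun v hv => hsF hv
  · rintro ⟨k, hk⟩
    obtain ⟨u, hu⟩ := hbne k.unpair.1
    have hopen : IsOpen (b k.unpair.1) := hb.isOpen (mem_range_self _)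
    -- Placing `x` at a far coordinate stays inside `b i` and obliges the learner to be correct; its
    -- limit there is `0`, the index of `y`.
    have ht : Tendsto (fun m => Function.update u m x) atTop (𝓝 u) := by
      rw [tendsto_pi_nhds]
      intro n
      refine tendsto_const_nhds.congr' ?_
      filter_upwards [eventually_gt_atTop n] with m hm
      rw [Function.update_of_ne hm.ne]
    obtain ⟨m, hm⟩ := (ht.eventually (hopen.mem_nhds hu)).exists
    obtain ⟨j, hj, hEj⟩ := hl (cons y (Function.update u m x)) x
      ⟨m + 1, by simpa [cons] using hE.refl x⟩
    have h0 : Tendsto (fun n => l n (cons y (Function.update u m x), x)) atTop (𝓝 0) := by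
      refine tendsto_const_nhds.congr' ?_
      filter_upwards [eventually_ge_atTop k.unpair.2] with n hn
      exact (hk _ hm n hn).symm
    rw [tendsto_nhds_unique hj h0] at hEj
    exact hEj

instance CantorSeq.instPerfectSpace : PerfectSpace CantorSeq := by
  refine perfectSpace_iff_forall_not_isolated.2 fun x => ?_
  have ht : Tendsto (fun m => Function.update x m (!x m)) atTop (𝓝[≠] x) := by
    refine tendsto_nhdsWithin_iff.2 ⟨?_, Eventually.of_forall fun m h => ?_⟩
    · rw [tendsto_pi_nhds]
      intro n
      refine tendsto_const_nhds.congr' ?_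
      filter_upwards [eventually_gt_atTop n] with m hm
      rw [Function.update_of_ne hm.ne]
    · have := congrFun h m
      simp at this
  exact ht.neBot

/-! ### The finite-injury construction -/

theorem List.IsPrefix.getElem?_eq_of_lt {α : Type*} {σ τ : List α} (h : σ <+: τ) {k : ℕ}
    (hk : k < σ.length) : τ[k]? = σ[k]? := by
  obtain ⟨ρ, rfl⟩ := h
  exact List.getElem?_append_left hk

/-- The functional with index `e`, run on some initial segment of `τ`, takes a value other than that
of `r`. -/
def Refutes (r : CantorSeq) (e : ℕ) (τ : List Bool) : Prop :=
  ∃ t ≤ τ.length, ∃ n v, v ∈ (Denumerable.ofNat Code e).runOn (τ.take t) n ∧ v ≠ (r n).toNat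

/-- `τ` extends `σ` and contains no new `true` in the rows below `e`. -/
def BlankExtends (e : ℕ) (σ τ : List Bool) : Prop :=
  σ <+: τ ∧ ∀ k, σ.length ≤ k → k.unpair.1 < e → τ[k]? ≠ some true

/-- The string `σ` can be extended, leaving the rows below `e` blank, to refute the functional with
index `e`, and does not refute it yet. -/
def CanRefute (r : CantorSeq) (e : ℕ) (σ : List Bool) : Prop :=
  ¬ Refutes r e σ ∧ ∃ τ, BlankExtends e σ τ ∧ Refutes r e τ

theorem Refutes.mono {r : CantorSeq} {e : ℕ} {σ τ : List Bool} (h : σ <+: τ)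
    (hσ : Refutes r e σ) : Refutes r e τ := by
  obtain ⟨t, ht, hσ⟩ := hσ
  refine ⟨t, ht.trans h.length_le, ?_⟩
  obtain ⟨ρ, rfl⟩ := h
  rwa [List.take_append_of_le_length ht]

/-- The position at which a string `σ` receives the information `r.initSeg s` in row `s.unpair.1`. -/
def codePos (r : CantorSeq) (s : ℕ) (σ : List Bool) : ℕ :=
  Nat.pair s.unpair.1 (Nat.pair σ.length (Encodable.encode (r.initSeg s)))

theorem length_le_codePos (r : CantorSeq) (s : ℕ) (σ : List Bool) : σ.length ≤ codePos r s σ :=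
  (Nat.left_le_pair _ _).trans (Nat.right_le_pair _ _)

/-- Extend `σ` by zeros and a single `true` at the position `codePos r s σ`. -/
def codeStep (r : CantorSeq) (s : ℕ) (σ : List Bool) : List Bool :=
  σ ++ (List.replicate (codePos r s σ - σ.length) false ++ [true])

theorem codeStep_getElem?_codePos (r : CantorSeq) (s : ℕ) (σ : List Bool) :
    (codeStep r s σ)[codePos r s σ]? = some true := by
  rw [codeStep, List.getElem?_append_right (length_le_codePos r s σ),
    List.getElem?_append_right (by simp)]
  simp

theorem eq_codePos_of_codeStep {r : CantorSeq} {s : ℕ} {σ : List Bool} {k : ℕ}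
    (hk : σ.length ≤ k) (h : (codeStep r s σ)[k]? = some true) : k = codePos r s σ := by
  have hle := length_le_codePos r s σ
  rw [codeStep, List.getElem?_append_right hk] at h
  by_cases hlt : k - σ.length < codePos r s σ - σ.length
  · rw [List.getElem?_append_left (by simpa using hlt), List.getElem?_replicate] at h
    simp [hlt] at h
  · have := (List.getElem?_eq_some_iff.1 h).1
    simp at this
    omega

open Classical in
/-- Extend `σ` to refute the functional with index `e`, if this is possible and needed. -/
noncomputable def refuteStep (r : CantorSeq) (e : ℕ) (σ : List Bool) : List Bool :=
  if h : CanRefute r e σ then h.2.choose else σ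

/-- The first half of a stage of the construction: if the current bit `b` is `true`, code an initial
segment of `r`. -/
def codeStage (r : CantorSeq) (s : ℕ) (b : Bool) (σ : List Bool) : List Bool :=
  if b then codeStep r s σ else σ

/-- The stages of the construction, controlled by `w`: if `w s` is `true`, then an initial segment of
`r` is coded into the row `s.unpair.1`, and then the functional with index `s.unpair.1` is refuted. -/
noncomputable def stage (r w : CantorSeq) : ℕ → List Bool
  | 0 => []
  -- The appended `false` forces the length to grow at every stage.
  | s + 1 => refuteStep r s.unpair.1 (codeStage r s (w s) (stage r w s)) ++ [false]

/-- The real built by the stages. -/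
noncomputable def stageLimit (r w : CantorSeq) : CantorSeq :=
  fun n => (stage r w (n + 1)).getD n false

section Stage

variable {r w : CantorSeq}

theorem prefix_refuteStep (r : CantorSeq) (e : ℕ) (σ : List Bool) : σ <+: refuteStep r e σ := by
  unfold refuteStep
  split_ifs with h
  · exact h.2.choose_spec.1.1
  · exact List.prefix_rfl

theorem prefix_codeStage (r : CantorSeq) (s : ℕ) (b : Bool) (σ : List Bool) :
    σ <+: codeStage r s b σ := by
  unfold codeStage
  split_ifs
  · exact List.prefix_append _ _
  · exact List.prefix_rfl

theorem codeStage_prefix_stage (r w : CantorSeq) (s : ℕ) :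
    codeStage r s (w s) (stage r w s) <+: stage r w (s + 1) :=
  (prefix_refuteStep _ _ _).trans (List.prefix_append _ _)

theorem stage_prefix_succ (r w : CantorSeq) (s : ℕ) : stage r w s <+: stage r w (s + 1) :=
  (prefix_codeStage _ _ _ _).trans (codeStage_prefix_stage r w s)

theorem stage_prefix (r w : CantorSeq) {s t : ℕ} (h : s ≤ t) : stage r w s <+: stage r w t := by
  induction t, h using Nat.le_induction with
  | base => exact List.prefix_rfl
  | succ t _ ih => exact ih.trans (stage_prefix_succ r w t)

theorem le_length_stage (r w : CantorSeq) (s : ℕ) : s ≤ (stage r w s).length := by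
  induction s with
  | zero => exact Nat.zero_le _
  | succ s ih =>
    have h := ((prefix_codeStage r s (w s) (stage r w s)).trans
      (prefix_refuteStep r s.unpair.1 _)).length_le
    simp only [stage, List.length_append, List.length_singleton]
    omega

theorem stage_getElem? (r w : CantorSeq) {s k : ℕ} (hk : k < (stage r w s).length) :
    (stage r w s)[k]? = some (stageLimit r w k) := by
  have hk' : k < (stage r w (k + 1)).length := le_length_stage r w (k + 1)
  have : (stage r w s)[k]? = (stage r w (k + 1))[k]? := by
    rcases le_total s (k + 1) with h | h
    · exact ((stage_prefix r w h).getElem?_eq_of_lt hk).symm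
    · exact (stage_prefix r w h).getElem?_eq_of_lt hk'
  rw [this, stageLimit, List.getD_eq_getElem?_getD, List.getElem?_eq_getElem hk']
  rfl

theorem eq_initSeg_stageLimit {σ : List Bool} {s : ℕ} (h : σ <+: stage r w s) :
    σ = (stageLimit r w).initSeg σ.length := by
  refine List.ext_getElem? fun k => ?_
  by_cases hk : k < σ.length
  · rw [CantorSeq.initSeg_getElem? _ hk, ← h.getElem?_eq_of_lt hk,
      stage_getElem? r w (hk.trans_le h.length_le)]
  · rw [List.getElem?_eq_none (not_lt.1 hk), List.getElem?_eq_none (by simpa using hk)]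

theorem refutes_stage_of_canRefute {s : ℕ}
    (h : CanRefute r s.unpair.1 (codeStage r s (w s) (stage r w s))) :
    Refutes r s.unpair.1 (stage r w (s + 1)) := by
  refine Refutes.mono (List.prefix_append _ _) ?_
  rw [refuteStep, dif_pos h]
  exact h.2.choose_spec.2

/-- A new `true` is either due to the coding, or due to a refutation, which spares the rows of
smaller index. -/
theorem stage_succ_getElem?_eq_true {s k : ℕ} (hk : (stage r w s).length ≤ k)
    (h : (stage r w (s + 1))[k]? = some true) :
    (w s = true ∧ k = codePos r s (stage r w s)) ∨
      (CanRefute r s.unpair.1 (codeStage r s (w s) (stage r w s)) ∧ s.unpair.1 ≤ k.unpair.1) := by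
  have hcode : (codeStage r s (w s) (stage r w s))[k]? = some true →
      w s = true ∧ k = codePos r s (stage r w s) := by
    intro h
    unfold codeStage at h
    split_ifs at h with hw
    · exact ⟨hw, eq_codePos_of_codeStep hk h⟩
    · rw [List.getElem?_eq_none hk] at h
      cases h
  have href : (refuteStep r s.unpair.1 (codeStage r s (w s) (stage r w s)))[k]? = some true := by
    rw [stage] at h
    rcases lt_or_ge k (refuteStep r s.unpair.1 (codeStage r s (w s) (stage r w s))).length
      with hlt | hge
    · rwa [List.getElem?_append_left hlt] at h
    · rw [List.getElem?_append_right hge] at h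
      have := List.mem_of_getElem? h
      simp at this
  by_cases hcan : CanRefute r s.unpair.1 (codeStage r s (w s) (stage r w s))
  · rw [refuteStep, dif_pos hcan] at href
    obtain ⟨hpre, hblank⟩ := hcan.2.choose_spec.1
    rcases lt_or_ge k (codeStage r s (w s) (stage r w s)).length with hlt | hge
    · rw [hpre.getElem?_eq_of_lt hlt] at href
      exact Or.inl (hcode href)
    · exact Or.inr ⟨hcan, not_lt.1 fun hlt => hblank k hge hlt href⟩
  · rw [refuteStep, dif_neg hcan] at href
    exact Or.inl (hcode href)

/-- The bit is attributed to the stage whose string first covers position `k`. -/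
theorem exists_stage_of_stageLimit_eq_true {s₀ k : ℕ} (hk : (stage r w s₀).length ≤ k)
    (h : stageLimit r w k = true) :
    ∃ s ≥ s₀, (w s = true ∧ k = codePos r s (stage r w s)) ∨
      (CanRefute r s.unpair.1 (codeStage r s (w s) (stage r w s)) ∧ s.unpair.1 ≤ k.unpair.1) := by
  classical
  have hex : ∃ s, k < (stage r w (s + 1)).length := ⟨k, le_length_stage r w (k + 1)⟩
  have hlt := Nat.find_spec hex
  have hle : (stage r w (Nat.find hex)).length ≤ k := by
    rcases hs : Nat.find hex with _ | t
    · exact Nat.zero_le _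
    · exact not_lt.1 (Nat.find_min hex (hs ▸ t.lt_succ_self))
  refine ⟨Nat.find hex, ?_, stage_succ_getElem?_eq_true hle ?_⟩
  · by_contra hs
    exact absurd ((stage_prefix r w (not_le.1 hs)).length_le.trans hk) (not_le.2 hlt)
  · rw [stage_getElem? r w hlt, h]

/-- The injury is finite: a refutation persists in all longer strings, so each index acts at most
once. -/
theorem eventually_not_canRefute (r w : CantorSeq) (e : ℕ) : ∀ᶠ s in atTop, s.unpair.1 < e →
    ¬ CanRefute r s.unpair.1 (codeStage r s (w s) (stage r w s)) := by
  have h : ∀ i ∈ Iio e, ∀ᶠ s in atTop, s.unpair.1 = i →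
      ¬ CanRefute r s.unpair.1 (codeStage r s (w s) (stage r w s)) := by
    intro i _
    by_cases hex : ∃ s, s.unpair.1 = i ∧
        CanRefute r s.unpair.1 (codeStage r s (w s) (stage r w s))
    · obtain ⟨s₀, rfl, hs₀⟩ := hex
      filter_upwards [eventually_gt_atTop s₀] with s hs hrow hcan
      rw [hrow] at hcan
      exact hcan.1 ((refutes_stage_of_canRefute hs₀).mono
        ((stage_prefix r w hs).trans (prefix_codeStage _ _ _ _)))
    · exact Eventually.of_forall fun s hs hcan => hex ⟨s, hs, hcan⟩
  filter_upwards [(eventually_all_finite (finite_Iio e)).2 h] with s hs hlt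
  exact hs _ hlt rfl

/-- Stage `s` depends only on the first `s` bits of `w`; the noneffective choices in `refuteStep` do
no harm to continuity. -/
theorem continuous_stageLimit (r : CantorSeq) : Continuous (stageLimit r) := by
  have hstage : ∀ s, IsLocallyConstant fun w => stage r w s := by
    intro s
    induction s with
    | zero => exact IsLocallyConstant.const _
    | succ s ih =>
      have hw : IsLocallyConstant fun w : CantorSeq => w s :=
        (IsLocallyConstant.iff_continuous _).2 (continuous_apply s)
      exact (ih.prodMk hw).comp fun p =>
        refuteStep r s.unpair.1 (codeStage r s p.2 p.1) ++ [false]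
  exact continuous_pi fun n => ((hstage (n + 1)).comp fun σ => σ.getD n false).continuous

/-- If a row of `w` is infinite, then `r` can be read off this row of the constructed real. -/
theorem turingReducible_stageLimit {i : ℕ} (hi : {j | w (Nat.pair i j) = true}.Infinite) :
    TuringReducible r.charFun (stageLimit r w).charFun := by
  rw [TuringReducible, RecursiveIn.iff_nat]
  -- Row `i` can be spoiled by indices up to and including `i`, hence `i + 1`. Beyond `p`, every
  -- `true` in this row codes a piece of `r`.
  obtain ⟨s₀, hs₀⟩ := eventually_atTop.1 (eventually_not_canRefute r w (i + 1))
  let p := (stage r w s₀).length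
  let H : List Bool → ℕ → Option ℕ := fun σ n =>
    if p < σ.length ∧ σ[σ.length - 1]? = some true ∧ (σ.length - 1).unpair.1 = i then
      ((Encodable.decode (σ.length - 1).unpair.2.unpair.2 : Option (List Bool)).bind
        fun l => l[n]?).map Bool.toNat
    else none
  have hH : Computable₂ H := by
    have hlen : Primrec fun q : List Bool × ℕ => q.1.length := Primrec.list_length.comp Primrec.fst
    have hpos : Primrec fun q : List Bool × ℕ => (q.1.length - 1).unpair :=
      Primrec.unpair.comp (Primrec.nat_sub.comp hlen (Primrec.const 1))
    have hc : PrimrecPred fun q : List Bool × ℕ => p < q.1.length ∧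
        q.1[q.1.length - 1]? = some true ∧ (q.1.length - 1).unpair.1 = i :=
      (Primrec.nat_lt.comp (Primrec.const p) hlen).and ((Primrec.eq.comp
        (Primrec.list_getElem?.comp Primrec.fst (Primrec.nat_sub.comp hlen (Primrec.const 1)))
        (Primrec.const (some true))).and
        (Primrec.eq.comp (Primrec.fst.comp hpos) (Primrec.const i)))
    refine Primrec.to_comp (Primrec.ite hc (Primrec.option_map (Primrec.option_bind
      (Primrec.decode.comp (Primrec.snd.comp (Primrec.unpair.comp (Primrec.snd.comp hpos)))) ?_) ?_)
      (Primrec.const none))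
    · exact Primrec.list_getElem?.comp Primrec.snd (Primrec.snd.comp Primrec.fst)
    · exact (Primrec.dom_finite Bool.toNat).comp Primrec.snd
  refine CantorSeq.recursiveIn_of_search hH (g := fun n => (r n).toNat) ?_ ?_
  · intro n s v hv
    simp only [H, CantorSeq.length_initSeg, Option.mem_def] at hv
    split_ifs at hv with hc
    obtain ⟨hps, hy, hrow⟩ := hc
    have hs : s - 1 < s := by omega
    rw [CantorSeq.initSeg_getElem? _ hs, Option.some_inj] at hy
    obtain ⟨t, ht, ⟨-, hpos⟩ | ⟨hcan, hle⟩⟩ :=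
      exists_stage_of_stageLimit_eq_true (s₀ := s₀) (Nat.le_sub_one_of_lt hps) hy
    · rw [hpos, codePos] at hv
      simp only [Nat.unpair_pair, Encodable.encodek, Option.bind_some, Option.map_eq_some_iff] at hv
      obtain ⟨b, hb, rfl⟩ := hv
      have hn : n < t := by simpa using (List.getElem?_eq_some_iff.1 hb).1
      rw [r.initSeg_getElem? hn] at hb
      cases hb
      rfl
    · exact (hs₀ t ht (by omega) hcan).elim
  · intro n
    obtain ⟨j, hj, hlt⟩ := hi.exists_gt (max s₀ n)
    have hs : max s₀ n < Nat.pair i j := hlt.trans_le (Nat.right_le_pair i j)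
    set s := Nat.pair i j with hsdef
    set k := codePos r s (stage r w s) with hkdef
    have hk : (stage r w (s + 1))[k]? = some true := by
      have h : (codeStage r s (w s) (stage r w s))[k]? = some true := by
        rw [codeStage, if_pos (show w s = true from hj)]
        exact codeStep_getElem?_codePos _ _ _
      rwa [(codeStage_prefix_stage r w s).getElem?_eq_of_lt (List.getElem?_eq_some_iff.1 h).1]
    have hy : stageLimit r w k = true := by
      have := stage_getElem? r w (List.getElem?_eq_some_iff.1 hk).1
      rw [hk] at this
      exact (Option.some_inj.1 this).symm
    have hpk : p ≤ k := (stage_prefix r w (by omega)).length_le.trans (length_le_codePos r s _)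
    refine ⟨k + 1, ?_⟩
    have hc : p < ((stageLimit r w).initSeg (k + 1)).length ∧
        ((stageLimit r w).initSeg (k + 1))[((stageLimit r w).initSeg (k + 1)).length - 1]? =
          some true ∧ (((stageLimit r w).initSeg (k + 1)).length - 1).unpair.1 = i := by
      refine ⟨by simpa using Nat.lt_succ_of_le hpk, ?_, ?_⟩
      · simp only [CantorSeq.length_initSeg, Nat.add_sub_cancel]
        rw [CantorSeq.initSeg_getElem? _ k.lt_succ_self, hy]
      · simp [hkdef, codePos, hsdef]
    simp only [H]
    rw [if_pos hc]
    have hn : n < s := by omega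
    simp [hkdef, codePos, r.initSeg_getElem? hn]

/-- If all rows of `w` are finite, then the constructed real does not compute a noncomputable `r`. -/
theorem not_turingReducible_stageLimit (hr : ¬ Computable fun n => (r n).toNat)
    (hw : ∀ i, {j | w (Nat.pair i j) = true}.Finite) :
    ¬ TuringReducible r.charFun (stageLimit r w).charFun := by
  intro hred
  rw [TuringReducible, RecursiveIn.iff_nat] at hred
  obtain ⟨c, sound, complete⟩ := Code.exists_runOn hred
  set y := stageLimit r w with hy
  let e := Encodable.encode c
  have hec : Denumerable.ofNat Code e = c := Denumerable.ofNat_encode c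
  -- Every stage is an initial segment of `y`, where `c` only gives correct values.
  have hsound : ∀ s, ∀ σ, σ <+: stage r w s → ¬ Refutes r e σ := by
    rintro s σ hσ ⟨t, ht, n, v, hv, hne⟩
    rw [eq_initSeg_stageLimit hσ, ← hy, CantorSeq.take_initSeg _ ht, hec] at hv
    exact hne (sound _ _ _ hv)
  have hrows : ∀ᶠ s in atTop, s.unpair.1 < e → w s = false := by
    have h : ∀ i ∈ Iio e, ∀ᶠ s in atTop, s.unpair.1 = i → w s = false := by
      intro i _
      have := (hw i).image (Nat.pair i)
      filter_upwards [Nat.cofinite_eq_atTop ▸ this.compl_mem_cofinite] with s hs hrow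
      by_contra hws
      refine hs ⟨s.unpair.2, ?_, ?_⟩
      · simpa [← hrow] using hws
      · rw [← hrow, Nat.pair_unpair]
    filter_upwards [(eventually_all_finite (finite_Iio e)).2 h] with s hs hlt
    exact hs _ hlt rfl
  obtain ⟨s₀, hs₀⟩ := eventually_atTop.1 (hrows.and (eventually_not_canRefute r w e))
  -- A stage devoted to `e` and not before `s₀`.
  set s₁ := Nat.pair e s₀ with hs₁
  have hrow₁ : s₁.unpair.1 = e := by simp [hs₁]
  set σ := codeStage r s₁ (w s₁) (stage r w s₁) with hσ
  have hσp : σ <+: stage r w (s₁ + 1) := codeStage_prefix_stage r w s₁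
  have hσy : σ = y.initSeg σ.length := eq_initSeg_stageLimit hσp
  -- Otherwise stage `s₁` would have refuted `e`.
  have hno : ∀ τ, BlankExtends e σ τ → ¬ Refutes r e τ := by
    intro τ hτ hRτ
    have hcan : CanRefute r s₁.unpair.1 σ := by
      rw [hrow₁]
      exact ⟨hsound _ _ hσp, τ, hτ, hRτ⟩
    have := refutes_stage_of_canRefute hcan
    rw [hrow₁] at this
    exact hsound _ _ List.prefix_rfl this
  have hblank : ∀ k, σ.length ≤ k → k.unpair.1 < e → y k = false := by
    intro k hk hke
    by_contra hyk
    have hk₀ : (stage r w s₀).length ≤ k :=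
      (((stage_prefix r w (Nat.right_le_pair e s₀)).trans
        (prefix_codeStage r s₁ (w s₁) _)).length_le).trans hk
    obtain ⟨s, hs, ⟨hws, hpos⟩ | ⟨hcan, hle⟩⟩ :=
      exists_stage_of_stageLimit_eq_true hk₀ (by simpa using hyk)
    · have hks : k.unpair.1 = s.unpair.1 := by rw [hpos, codePos, Nat.unpair_pair]
      have := (hs₀ s hs).1 (hks ▸ hke)
      rw [hws] at this
      cases this
    · exact (hs₀ s hs).2 (hle.trans_lt hke) hcan
  -- Forces any `l` to extend `σ` blankly: past the end of `σ`, the value of `σ.getD k false` is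
  -- `false`. By `hblank`, initial segments of `y` are unchanged, so searching all masked strings
  -- computes `r` without an oracle.
  let mask : List Bool → CantorSeq := fun l k =>
    if k < σ.length ∨ k.unpair.1 < e then σ.getD k false else l.getD k false
  have hσmask : ∀ l, σ = (mask l).initSeg σ.length := by
    intro l
    refine List.ext_getElem? fun k => ?_
    by_cases hk : k < σ.length
    · rw [CantorSeq.initSeg_getElem? _ hk, List.getElem?_eq_getElem hk]
      simp [mask, hk]
    · rw [List.getElem?_eq_none (not_lt.1 hk), List.getElem?_eq_none (by simpa using hk)]
  have hmaskExt : ∀ l t, σ.length ≤ t → BlankExtends e σ ((mask l).initSeg t) := by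
    intro l t ht
    refine ⟨?_, fun k hk hke htrue => ?_⟩
    · conv_lhs => rw [hσmask l]
      exact (mask l).initSeg_prefix ht
    · have hkt : k < t := by simpa using (List.getElem?_eq_some_iff.1 htrue).1
      rw [CantorSeq.initSeg_getElem? _ hkt] at htrue
      simp [mask, hke, List.getElem?_eq_none hk] at htrue
  have hmask : Primrec fun l : List Bool => (mask l).initSeg l.length := by
    refine Primrec.list_map (Primrec.list_range.comp Primrec.list_length) ?_
    refine Primrec.ite ((Primrec.nat_lt.comp Primrec.snd (Primrec.const _)).or
      (Primrec.nat_lt.comp (Primrec.fst.comp (Primrec.unpair.comp Primrec.snd))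
        (Primrec.const _)))
      ((Primrec.list_getD false).comp (Primrec.const σ) Primrec.snd)
      ((Primrec.list_getD false).comp Primrec.fst Primrec.snd)
  let G : ℕ → ℕ → Option ℕ := fun n m =>
    (Encodable.decode m : Option (List Bool)).bind fun l => c.runOn ((mask l).initSeg l.length) n
  have hG : Computable₂ G := Computable.option_bind (Computable.decode.comp Computable.snd)
    (c.computable_runOn.comp (hmask.to_comp.comp Computable.snd)
      (Computable.fst.comp Computable.fst))
  have Gsound : ∀ n m v, v ∈ G n m → v = (r n).toNat := by
    intro n m v hv
    obtain ⟨l, -, hv⟩ := Option.bind_eq_some_iff.1 hv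
    by_contra hne
    -- The masked string may be shorter than `σ`; the longer one extends `σ` and keeps it as a
    -- prefix, which is what `Refutes` inspects.
    refine hno _ (hmaskExt l (max l.length σ.length) (le_max_right _ _))
      ⟨l.length, by simp, n, v, ?_, hne⟩
    rw [hec, CantorSeq.take_initSeg _ (le_max_left _ _)]
    exact hv
  have Gcomplete : ∀ n, ∃ m, (r n).toNat ∈ G n m := by
    intro n
    obtain ⟨s, hs⟩ := complete n
    refine ⟨Encodable.encode (y.initSeg s), ?_⟩
    have hmy : (mask (y.initSeg s)).initSeg s = y.initSeg s := by
      refine List.map_congr_left fun k hk => ?_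
      have hk : k < s := List.mem_range.1 hk
      by_cases hkσ : k < σ.length
      · have := congrArg (fun l : List Bool => l.getD k false) hσy
        simp only [List.getD_eq_getElem?_getD, CantorSeq.initSeg_getElem? y hkσ] at this
        simpa [mask, hkσ] using this
      · by_cases hke : k.unpair.1 < e
        · rw [hblank k (not_lt.1 hkσ) hke]
          simp [mask, hke, List.getElem?_eq_none (not_lt.1 hkσ)]
        · simp [mask, hkσ, hke, CantorSeq.initSeg_getElem? y hk]
    simpa [G, hmy] using hs
  refine hr (Partrec.of_eq_tot (Partrec.rfindOpt hG) fun n => ?_)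
  obtain ⟨m, hm⟩ := Gcomplete n
  have hdom : (Nat.rfindOpt (G n)).Dom := Nat.rfindOpt_dom.2 ⟨m, _, hm⟩
  obtain ⟨t, ht⟩ := Nat.rfindOpt_spec (Part.get_mem hdom)
  exact Gsound n t _ ht ▸ Part.get_mem hdom

end Stage

/-! ### The upper bound, the reduction and the conclusion -/

theorem exists_not_computable : ∃ r : CantorSeq, ¬ Computable fun n => (r n).toNat := by
  by_contra! h
  have hc : ∀ r : CantorSeq, ∃ c : Code, c.eval = fun n => Part.some (r n).toNat := fun r =>
    Code.exists_code.1 (Partrec.nat_iff.1 (h r))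
  choose c hc using hc
  have hinj : Function.Injective c := by
    intro r s hrs
    funext n
    have := congrFun ((hc r).symm.trans (hrs ▸ hc s)) n
    have := Part.some_inj.1 this
    revert this
    cases r n <;> cases s n <;> simp
  classical
  refine Function.cantor_injective
    (fun S : Set ℕ => Encodable.encode (c fun n => decide (n ∈ S))) fun S T h => ?_
  ext n
  simpa using congrFun (hinj (Encodable.encode_injective h)) n

theorem Nat.mem_rfindOpt_iff {α : Type*} {h : ℕ → Option α} {v : α} :
    v ∈ Nat.rfindOpt h ↔ ∃ s, v ∈ h s ∧ ∀ t < s, h t = none := by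
  have hb : ∀ b b' : Bool, b ∈ (Option.some b' : Part Bool) ↔ b' = b := fun b b' =>
    Part.mem_some_iff.trans eq_comm
  refine Part.mem_bind_iff.trans (exists_congr fun s => ?_)
  refine (and_congr Nat.mem_rfind Part.mem_ofOption).trans ?_
  simp only [hb, Option.isSome_eq_false_iff, Option.isNone_iff_eq_none]
  constructor
  · rintro ⟨⟨-, hlt⟩, hv⟩
    exact ⟨hv, by intro t ht; exact hlt ht⟩
  · rintro ⟨hv, hlt⟩
    exact ⟨⟨Option.isSome_of_mem hv, by intro t ht; apply hlt; exact ht⟩, hv⟩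

theorem CantorSeq.isLocallyConstant_initSeg (s : ℕ) :
    IsLocallyConstant fun y : CantorSeq => y.initSeg s := by
  induction s with
  | zero => exact IsLocallyConstant.const _
  | succ s ih =>
    simp_rw [CantorSeq.initSeg_succ]
    exact ih.comp₂ ((IsLocallyConstant.iff_continuous _).2 (continuous_apply s)) fun l b => l ++ [b]

theorem boldSigma_three_turingEquivReal :
    BoldSigma 3 {p : CantorSeq × CantorSeq | TuringEquivReal p.1 p.2} := by
  let V : Code → ℕ → Set (CantorSeq × CantorSeq) := fun c n =>
    {p | (p.1 n).toNat ∈ Nat.rfindOpt fun s => c.runOn (p.2.initSeg s) n}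
  have hV : ∀ c n, IsOpen (V c n) := by
    intro c n
    -- That `s` is the first success and yields `x n` depends only on `x n` and `y.initSeg s`:
    -- shorter segments are its prefixes.
    have : V c n = ⋃ s, (fun p : CantorSeq × CantorSeq => (p.1 n, p.2.initSeg s)) ⁻¹'
        {q | q.1.toNat ∈ c.runOn q.2 n ∧ ∀ t < s, c.runOn (q.2.take t) n = none} := by
      ext p
      simp only [V, mem_ofPred_eq, Nat.mem_rfindOpt_iff, mem_iUnion, mem_preimage]
      refine exists_congr fun s => and_congr_right fun _ => forall₂_congr fun t ht => ?_
      rw [CantorSeq.take_initSeg _ ht.le]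
    rw [this]
    exact isOpen_iUnion fun s => (((IsLocallyConstant.iff_continuous _).2
      ((continuous_apply n).comp continuous_fst)).prodMk
      ((CantorSeq.isLocallyConstant_initSeg s).comp_continuous continuous_snd)) _
  have hred : ∀ p : CantorSeq × CantorSeq, TuringReducible p.1.charFun p.2.charFun ↔
      ∃ c, ∀ n, p ∈ V c n := fun p => turingReducible_charFun_iff
  let O : ℕ → ℕ → Set (CantorSeq × CantorSeq) := fun i n =>
    V (Denumerable.ofNat Code i.unpair.1) n ∩
      Prod.swap ⁻¹' V (Denumerable.ofNat Code i.unpair.2) n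
  have hO : {p : CantorSeq × CantorSeq | TuringEquivReal p.1 p.2} = ⋃ i, ⋂ n, O i n := by
    ext p
    have h : TuringEquivReal p.1 p.2 ↔ (∃ c, ∀ n, p ∈ V c n) ∧ ∃ c, ∀ n, p.swap ∈ V c n :=
      and_congr (hred p) (hred p.swap)
    simp only [mem_ofPred_eq, h, mem_iUnion, mem_iInter, O, mem_inter_iff, mem_preimage]
    constructor
    · rintro ⟨⟨c, hc⟩, d, hd⟩
      exact ⟨Nat.pair (Encodable.encode c) (Encodable.encode d), fun n => by
        simpa using ⟨hc n, hd n⟩⟩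
    · rintro ⟨i, hi⟩
      exact ⟨⟨_, fun n => (hi n).1⟩, _, fun n => (hi n).2⟩
  rw [hO]
  exact boldSigma_three_iUnion_iInter fun i n => (hV _ n).inter ((hV _ n).preimage continuous_swap)

/-- A code together with the oracle `x` determines `y`. -/
theorem countable_turingEquivReal (x : CantorSeq) : {y | TuringEquivReal x y}.Countable := by
  have hc : ∀ y : {y | TuringEquivReal x y}, ∃ c : Code, ∀ n,
      (y.1 n).toNat ∈ Nat.rfindOpt fun s => c.runOn (x.initSeg s) n :=
    fun y => turingReducible_charFun_iff.1 y.2.2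
  choose c hc using hc
  have hinj : Function.Injective c := by
    intro y z hyz
    ext n
    have := Part.mem_unique (hc y n) (hyz ▸ hc z n)
    revert this
    cases y.1 n <;> cases z.1 n <;> simp
  exact hinj.countable

/-- The reduction is `z ↦ (r ⊕ y, y)` with `y = stageLimit r (w z)`. -/
theorem exists_continuous_preimage_turingEquivReal {X : Type*} [TopologicalSpace X]
    [SecondCountableTopology X]
    (hX : TopologicalSpace.IsTopologicalBasis {s : Set X | IsClopen s}) {B : Set X}
    (hB : BoldSigma 3 B) : ∃ f : X → CantorSeq × CantorSeq, Continuous f ∧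
      f ⁻¹' {p : CantorSeq × CantorSeq | TuringEquivReal p.1 p.2} = B := by
  obtain ⟨r, hr⟩ := exists_not_computable
  obtain ⟨w, hw, hwB⟩ := hB.exists_continuous_infinite_row hX
  have hy : Continuous fun z => stageLimit r (w z) := (continuous_stageLimit r).comp hw
  refine ⟨fun z => (r.join (stageLimit r (w z)), stageLimit r (w z)), Continuous.prodMk ?_ hy, ?_⟩
  · refine continuous_pi fun n => ?_
    unfold CantorSeq.join
    split_ifs
    · exact continuous_const
    · exact (continuous_apply (A := fun _ => Bool) (n / 2)).comp hy
  · ext z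
    rw [mem_preimage, mem_ofPred_eq, turingEquivReal_join_iff, hwB]
    refine ⟨fun h => ?_, fun ⟨i, hi⟩ => turingReducible_stageLimit hi⟩
    by_contra! hfin
    exact not_turingReducible_stageLimit hr hfin h

theorem mainTheorem8 :
    ¬ IsLearnable TuringEquivReal ∧
    ¬ BoldPi 3 {p : CantorSeq × CantorSeq | TuringEquivReal p.1 p.2} ∧
    BoldSigmaComplete.{u, 0} 3 {p : CantorSeq × CantorSeq | TuringEquivReal p.1 p.2} := by
  have hpi : ¬ BoldPi 3 {p : CantorSeq × CantorSeq | TuringEquivReal p.1 p.2} := by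
    intro h
    obtain ⟨D, hD, hDpi⟩ := exists_boldSigma_three_not_boldPi_three
    obtain ⟨f, hf, rfl⟩ := exists_continuous_preimage_turingEquivReal
      isTopologicalBasis_isClopen hD
    exact hDpi (BoldSigma.preimage hf h)
  have heq : Equivalence TuringEquivReal := by
    exact ⟨fun _ => TuringEquivalent.refl _, fun h => TuringEquivalent.symm h,
      fun h h' => TuringEquivalent.trans _ _ _ h h'⟩
  refine ⟨fun h => hpi (h.boldSigma_two heq countable_turingEquivReal).boldPi_succ, hpi,
    boldSigma_three_turingEquivReal, fun X _ _ hX B hB => ?_⟩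
  exact exists_continuous_preimage_turingEquivReal hX hB
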